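/- Let $V=V_b\cup V_r$ be a finite set of nodes, with $V_r\neq\emptyset$ the reference nodes, and let each node $u$ have a constant variable $x_u\in\mathbb R$, known at the reference nodes (e.g. $x_u=0$ for $u\in V_r$). For $k=0,1,\dots$ let $\mathcal G(k)=(V,\mathcal E(k))$ be a deterministic sequence of undirected graphs, put $a_{uv}(k)=1$ if $(u,v)\in\mathcal E(k)$ and $a_{uv}(k)=0$ otherwise, and let $\mathcal N_u(k)$ be the set of neighbors of $u$ in $\mathcal G(k)$. In the DiSync algorithm the reference nodes keep $\hat x_u(k)=x_u$, and every $u\in V_b$ starts from some $\hat x_u(0)$ and updates $$\hat x_u(k+1)=\hat x_u(k)+m(k)\sum_{v\in\mathcal N_u(k)}\bigl(\hat x_v(k)+\zeta_{u,v}(k)-\hat x_u(k)\bigr),\qquad \zeta_{u,v}(k)=x_u-x_v+\epsilon_{u,v}(k).$$ Let $e(k)=(\hat x_u(k)-x_u)_{u\in V_b}$ be the estimation error and $\epsilon(k)=(\epsilon_{u,v}(k))_{u\in V_b,\,v\in V,\,v\ne u}$ the noise vector. Let $L(k)$ be the Laplacian of $\mathcal G(k)$, $L_b(k)$ (the grounded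 Laplacian) its submatrix with rows and columns in $V_b$, and $D(k)$ the block diagonal matrix whose block for $u\in V_b$ is the row $(a_{uv}(k))_{v\in V,\,v\neq u}$, so that $$e(k+1)=(I-m(k)L_b(k))\,e(k)+m(k)D(k)\,\epsilon(k).$$ Assume: 1. $E[\epsilon(k)]=\gamma$ for all $k$, $\sup_k E\|\epsilon(k)\|^2<\infty$, $\epsilon(k)$ and $\epsilon(j)$ are independent for $k\ne j$, the sequence $\{\epsilon(k)\}_{k\ge0}$ is independent of $e(0)$, and $E\|e(0)\|^2<\infty$; 2. $m(k)=\frac{c_1}{k+c_2}$ for all $k\ge 0$, with constants $c_1,c_2>0$; 3. there is $d\in\mathbb N$ such that for every $t\ge 0$ the graph $\bigl(V,\bigcup_{k=t}^{t+d-1}\mathcal E(k)\bigr)$ is connected; 4. the limits $\bar L=\lim_{t\to\infty}\frac1t\sum_{k=0}^tL(k)$, $\bar L_b=\lim_{t\to\infty}\frac1t\sum_{k=0}^tL_b(k)$ and $\bar D=\lim_{t\to\infty}\frac1t\sum_{k=0}^tD(k)$ exist. Then $\bar L_b$ is invertible and $e(k)$ converges to $\bar L_b^{-1}\bar D\gamma$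 in mean square: $$\lim_{k\to\infty}E\bigl\|e(k)-\bar L_b^{-1}\bar D\gamma\bigr\|^2=0 .$$ In particular, if the measurements are unbiased ($\gamma=0$), then $\lim_{k\to\infty}E\|e(k)\|^2=0$. -/

import Mathlib

open MeasureTheory ProbabilityTheory Filter Topology

/-- Grounded (Dirichlet) Laplacian: the Laplacian with the rows and columns of the
reference nodes `R` removed. Nodes are `B ⊕ R`, where `B` are the non-reference nodes. -/
def groundedLaplacian {B R : Type*} [Fintype B] [Fintype R] [DecidableEq B] [DecidableEq R]
    (G : SimpleGraph (B ⊕ R)) [DecidableRel G.Adj] : Matrix B B ℝ :=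
  (G.lapMatrix ℝ).submatrix Sum.inl Sum.inl

/-- Ordered pairs `(u, v)` with `u` a non-reference node and `v ≠ u` any node. -/
abbrev NodePair (B R : Type*) := {p : B × (B ⊕ R) // p.2 ≠ Sum.inl p.1}

/-- The block diagonal matrix `diag(ā_1, …, ā_{n_b})`, where `ā_u` is the row of the
weights `a_{uv}`, `v ≠ u` (with `a_{uv} = 1` on edges and `0` otherwise). -/
def weightMatrix {B R : Type*} [DecidableEq B]
    (G : SimpleGraph (B ⊕ R)) [DecidableRel G.Adj] : Matrix B (NodePair B R) ℝ :=
  Matrix.of fun u p => if p.1.1 = u then G.adjMatrix ℝ (Sum.inl u) p.1.2 else 0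

/-- The noises `ξ_{u,v}`, `v ≠ u`, stacked into one vector. -/
def stackedNoise {B R : Type*} (ξ : B → B ⊕ R → ℝ) : EuclideanSpace ℝ (NodePair B R) :=
  WithLp.toLp 2 fun p => ξ p.1.1 p.1.2

/-- The noisy difference measurement `ζ_{u,v} = x_u - x_v + ξ_{u,v}` used by node `u`. -/
def diffMeasurement {B R : Type*} (x : B ⊕ R → ℝ) (ξ : B → B ⊕ R → ℝ)
    (u : B) (v : B ⊕ R) : ℝ :=
  x (Sum.inl u) - x v + ξ u v

/-- The estimates of the DiSync algorithm with gains `m`, measurement graphs `G`, node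
variables `x`, measurement noises `ξ`, and initial estimates `x₀` at the non-reference nodes.
Reference nodes know their node variables and do not update. -/
def diSyncEstimate {B R : Type*} [Fintype B] [Fintype R]
    (m : ℕ → ℝ) (G : ℕ → SimpleGraph (B ⊕ R)) [∀ k, DecidableRel (G k).Adj]
    (x : B ⊕ R → ℝ) (ξ : ℕ → B → B ⊕ R → ℝ) (x₀ : B → ℝ) : ℕ → B ⊕ R → ℝ
  | 0 => Sum.elim x₀ (fun r => x (Sum.inr r))
  | k + 1 => Sum.elim
      (fun u => diSyncEstimate m G x ξ x₀ k (Sum.inl u) +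
        m k * ∑ v ∈ (G k).neighborFinset (Sum.inl u),
          (diSyncEstimate m G x ξ x₀ k v + diffMeasurement x (ξ k) u v
            - diSyncEstimate m G x ξ x₀ k (Sum.inl u)))
      (fun r => x (Sum.inr r))

/-- The estimation error `e_u(k) = x̂_u(k) - x_u` at the non-reference nodes. -/
def diSyncError {B R : Type*} [Fintype B] [Fintype R]
    (m : ℕ → ℝ) (G : ℕ → SimpleGraph (B ⊕ R)) [∀ k, DecidableRel (G k).Adj]
    (x : B ⊕ R → ℝ) (ξ : ℕ → B → B ⊕ R → ℝ) (x₀ : B → ℝ) (k : ℕ) : EuclideanSpace ℝ B :=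
  WithLp.toLp 2 fun u => diSyncEstimate m G x ξ x₀ k (Sum.inl u) - x (Sum.inl u)

/-- The time average `(1/t) ∑_{k=0}^{t} A(k)`. -/
noncomputable def timeAverage {M : Type*} [AddCommMonoid M] [Module ℝ M] (A : ℕ → M) (t : ℕ) : M :=
  (t : ℝ)⁻¹ • ∑ k ∈ Finset.range (t + 1), A k

/-!
By averaging, `m k • L_b k` acts in the long run like `m k • L̄_b`. This is made exact by the
near-identity change of variables `z k = e k + H k (e k)`, where `H k` is `m k` times the
accumulated fluctuation of the affine drifts `y ↦ L_b k y - D k γ` about their time average: since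
`m` varies slowly and the fluctuations average out, `H k → 0` and the drift becomes its time average
up to a remainder `o(m k)`. The averaged drift is a contraction towards `L̄_b⁻¹ D̄ γ`: only finitely
many graphs occur, so uniform joint connectivity bounds below the sum over each window of the
Dirichlet forms `y ⬝ᵥ L_b k y`, hence `L̄_b` has positive quadratic form. The centred noise is
uncorrelated with the current error, so it adds only `O(m k ^ 2)` to the mean square of `z k`, and a
discrete Grönwall argument with `∑ m k = ∞` concludes.
-/

open Asymptotics

section TimeAverage

variable {M N : Type*}

lemma tendsto_timeAverage_map [AddCommMonoid M] [Module ℝ M] [TopologicalSpace M]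
    [AddCommMonoid N] [Module ℝ N] [TopologicalSpace N] (φ : M →L[ℝ] N)
    {A : ℕ → M} {A' : M} (hA : Tendsto (timeAverage A) atTop (𝓝 A')) :
    Tendsto (timeAverage fun k => φ (A k)) atTop (𝓝 (φ A')) := by
  have hmap : timeAverage (fun k => φ (A k)) = φ ∘ timeAverage A := by
    ext t
    simp [timeAverage]
  exact hmap ▸ (φ.continuous.tendsto A').comp hA

lemma tendsto_timeAverage_prodMk [AddCommMonoid M] [Module ℝ M] [TopologicalSpace M]
    [AddCommMonoid N] [Module ℝ N] [TopologicalSpace N] {A : ℕ → M} {A' : M} {D : ℕ → N} {D' : N}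
    (hA : Tendsto (timeAverage A) atTop (𝓝 A')) (hD : Tendsto (timeAverage D) atTop (𝓝 D')) :
    Tendsto (timeAverage fun k => (A k, D k)) atTop (𝓝 (A', D')) := by
  refine (hA.prodMk_nhds hD).congr fun t => ?_
  simp [timeAverage, Prod.ext_iff, Prod.fst_sum, Prod.snd_sum]

lemma pos_of_tendsto_timeAverage {q : ℕ → ℝ} {a δ : ℝ} {d : ℕ} (hq : ∀ k, 0 ≤ q k) (hδ : 0 < δ)
    (hwindow : ∀ t, δ ≤ ∑ k ∈ Finset.Ico t (t + d), q k)
    (ha : Tendsto (timeAverage q) atTop (𝓝 a)) : 0 < a := by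
  have hd : 0 < d := Nat.pos_of_ne_zero fun h => by simpa [h] using hδ.trans_le (hwindow 0)
  have hd' : (0 : ℝ) < d := Nat.cast_pos.2 hd
  have hsum (n : ℕ) : n * δ ≤ ∑ k ∈ Finset.range (n * d), q k := by
    induction n with
    | zero => simp
    | succ n ih =>
      rw [Nat.succ_mul, ← Finset.sum_range_add_sum_Ico q (Nat.le_add_right (n * d) d)]
      push_cast
      linarith [hwindow (n * d)]
  have hblocks : Tendsto (fun n : ℕ => (n + 1) * d) atTop atTop :=
    tendsto_atTop_mono (fun n => (Nat.le_succ n).trans (Nat.le_mul_of_pos_right _ hd)) tendsto_id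
  refine (div_pos hδ hd').trans_le
    (ge_of_tendsto (ha.comp hblocks) (Eventually.of_forall fun n => ?_))
  calc δ / d = (((n + 1) * d : ℕ) : ℝ)⁻¹ * ((n + 1 : ℕ) * δ) := by
        push_cast
        field_simp
    _ ≤ (((n + 1) * d : ℕ) : ℝ)⁻¹ * ∑ k ∈ Finset.range ((n + 1) * d + 1), q k := by
        gcongr
        rw [Finset.sum_range_succ]
        linarith [hsum (n + 1), hq ((n + 1) * d)]

variable [NormedAddCommGroup M] [NormedSpace ℝ M]

lemma isLittleO_sum_sub_of_tendsto_timeAverage {A : ℕ → M} {A' : M}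
    (hA : Tendsto (timeAverage A) atTop (𝓝 A')) :
    (fun t : ℕ => ∑ k ∈ Finset.range (t + 1), (A k - A')) =o[atTop] fun t : ℕ => (t : ℝ) := by
  have havg : (fun t : ℕ => (t : ℝ) • (timeAverage A t - A')) =o[atTop] fun t : ℕ => (t : ℝ) := by
    simpa using (isBigO_refl (fun t : ℕ => (t : ℝ)) atTop).smul_isLittleO
      ((isLittleO_one_iff ℝ).2 (tendsto_sub_nhds_zero_iff.2 hA))
  have hconst : (fun _ : ℕ => A') =o[atTop] fun t : ℕ => (t : ℝ) :=
    isLittleO_const_left.2 (Or.inr (tendsto_norm_atTop_atTop.comp tendsto_natCast_atTop_atTop))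
  refine (havg.sub hconst).congr' ?_ EventuallyEq.rfl
  filter_upwards [eventually_ne_atTop 0] with t ht
  rw [timeAverage, smul_sub, smul_inv_smul₀ (Nat.cast_ne_zero.2 ht), Finset.sum_sub_distrib,
    Finset.sum_const, Finset.card_range, ← Nat.cast_smul_eq_nsmul ℝ, Nat.cast_succ, add_smul,
    one_smul, sub_sub]

end TimeAverage

section Gain

/-- Gains for which the method of averaging works: they decay like `1 / k` at most, they are not
summable, and they vary slowly. The two asymptotic bounds say nothing about `k = 0`, where
`(k : ℝ)⁻¹` and `m k / k` are junk. -/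
structure IsAveragingGain (m : ℕ → ℝ) : Prop where
  nonneg : ∀ k, 0 ≤ m k
  tendsto_sum : Tendsto (fun n => ∑ k ∈ Finset.range n, m k) atTop atTop
  isBigO_inv : m =O[atTop] fun k => (k : ℝ)⁻¹
  isBigO_succ_sub : (fun k => m (k + 1) - m k) =O[atTop] fun k => m k / k

lemma isAveragingGain_div_add {c₁ c₂ : ℝ} (hc₁ : 0 < c₁) (hc₂ : 0 < c₂) :
    IsAveragingGain fun k => c₁ / (k + c₂) where
  nonneg k := by positivity
  tendsto_sum := by
    rw [← not_summable_iff_tendsto_nat_atTop_of_nonneg fun k => by positivity]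
    intro hsum
    refine (Real.summable_one_div_nat_add_rpow c₂ 1).not.2 (lt_irrefl 1)
      ((hsum.mul_left c₁⁻¹).congr fun k => ?_)
    rw [Real.rpow_one, abs_of_pos (by positivity)]
    field_simp
  isBigO_inv := by
    refine IsBigO.of_bound c₁ ?_
    filter_upwards [eventually_gt_atTop 0] with k hk
    have : (0 : ℝ) < k := Nat.cast_pos.2 hk
    rw [Real.norm_of_nonneg (by positivity), Real.norm_of_nonneg (by positivity), div_eq_mul_inv]
    gcongr
    linarith
  isBigO_succ_sub := by
    refine IsBigO.of_bound 1 ?_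
    filter_upwards [eventually_gt_atTop 0] with k hk
    have : (0 : ℝ) < k := Nat.cast_pos.2 hk
    have hdiff : c₁ / ((k + 1 : ℕ) + c₂) - c₁ / (k + c₂) =
        -(c₁ / (k + c₂) / (k + 1 + c₂)) := by
      push_cast
      field_simp
      ring
    rw [hdiff, norm_neg, one_mul, Real.norm_of_nonneg (by positivity),
      Real.norm_of_nonneg (by positivity)]
    gcongr
    linarith

lemma IsAveragingGain.tendsto_zero {m : ℕ → ℝ} (hm : IsAveragingGain m) :
    Tendsto m atTop (𝓝 0) :=
  hm.isBigO_inv.trans_tendsto tendsto_inv_atTop_nhds_zero_nat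

variable {M : Type*} [NormedAddCommGroup M] [NormedSpace ℝ M]

/-- The corrector `m k • ∑_{j < k} (A j - A')` of the method of averaging. It solves the discrete
homological equation: its increment cancels the fluctuation `m k • (A k - A')` of the drift up to
a remainder `o(m k)`. -/
def averagingCorrector (m : ℕ → ℝ) (A : ℕ → M) (A' : M) (k : ℕ) : M :=
  m k • ∑ j ∈ Finset.range k, (A j - A')

variable {m : ℕ → ℝ} {A : ℕ → M} {A' : M}

lemma tendsto_averagingCorrector (hm : IsAveragingGain m)
    (hA : Tendsto (timeAverage A) atTop (𝓝 A')) :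
    Tendsto (averagingCorrector m A A') atTop (𝓝 0) := by
  rw [← tendsto_add_atTop_iff_nat 1, ← isLittleO_one_iff ℝ]
  have hm_succ : (fun k => m (k + 1)) =O[atTop] fun k : ℕ => (k : ℝ)⁻¹ := by
    refine (hm.isBigO_inv.comp_tendsto (tendsto_add_atTop_nat 1)).trans (IsBigO.of_bound 1 ?_)
    filter_upwards [eventually_gt_atTop 0] with k hk
    have : (0 : ℝ) < k := Nat.cast_pos.2 hk
    simp only [Function.comp_apply, norm_inv, RCLike.norm_natCast, one_mul]
    gcongr
    simp
  refine (hm_succ.smul_isLittleO (isLittleO_sum_sub_of_tendsto_timeAverage hA)).congr'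
    EventuallyEq.rfl ?_
  filter_upwards [eventually_ne_atTop 0] with k hk
  exact inv_mul_cancel₀ (Nat.cast_ne_zero.2 hk)

lemma isLittleO_averagingCorrector_succ_sub (hm : IsAveragingGain m)
    (hA : Tendsto (timeAverage A) atTop (𝓝 A')) :
    (fun k => averagingCorrector m A A' (k + 1) - averagingCorrector m A A' k -
      m k • (A k - A')) =o[atTop] m := by
  refine (hm.isBigO_succ_sub.smul_isLittleO
    (isLittleO_sum_sub_of_tendsto_timeAverage hA)).congr' (Eventually.of_forall fun k => ?_) ?_
  · simp only [averagingCorrector, Finset.sum_range_succ]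
    module
  · filter_upwards [eventually_ne_atTop 0] with k hk
    exact div_mul_cancel₀ _ (Nat.cast_ne_zero.2 hk)

end Gain

section Contraction

lemma tendsto_zero_of_le_one_sub_mul {p α : ℕ → ℝ} (hp : ∀ k, 0 ≤ p k)
    (hα : Tendsto (fun n => ∑ k ∈ Finset.range n, α k) atTop atTop)
    (h : ∀ᶠ k in atTop, p (k + 1) ≤ (1 - α k) * p k) : Tendsto p atTop (𝓝 0) := by
  obtain ⟨K, hK⟩ := eventually_atTop.1 h
  have hbound : ∀ k ≥ K,
      p k ≤ Real.exp (∑ j ∈ Finset.range K, α j - ∑ j ∈ Finset.range k, α j) * p K := by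
    intro k hk
    induction k, hk using Nat.le_induction with
    | base => simp
    | succ k hk ih =>
      calc p (k + 1) ≤ (1 - α k) * p k := hK k hk
        _ ≤ Real.exp (-α k) * p k := by
            gcongr
            · exact hp k
            · exact Real.one_sub_le_exp_neg (α k)
        _ ≤ Real.exp (-α k) * (Real.exp (∑ j ∈ Finset.range K, α j -
              ∑ j ∈ Finset.range k, α j) * p K) := by gcongr
        _ = _ := by
            rw [← mul_assoc, ← Real.exp_add, Finset.sum_range_succ]
            ring_nf
  refine squeeze_zero' (Eventually.of_forall hp) (eventually_atTop.2 ⟨K, hbound⟩) ?_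
  rw [← zero_mul (p K)]
  exact (Real.tendsto_exp_atBot.comp
    (tendsto_atBot_add_const_left _ _ (tendsto_neg_atTop_atBot.comp hα))).mul_const _

lemma tendsto_zero_of_le_one_sub_mul_add {a b α : ℕ → ℝ} (ha : ∀ k, 0 ≤ a k)
    (hα₀ : ∀ k, 0 ≤ α k) (hα₁ : ∀ᶠ k in atTop, α k ≤ 1)
    (hα : Tendsto (fun n => ∑ k ∈ Finset.range n, α k) atTop atTop)
    (hb : Tendsto b atTop (𝓝 0))
    (h : ∀ᶠ k in atTop, a (k + 1) ≤ (1 - α k) * a k + α k * b k) : Tendsto a atTop (𝓝 0) := by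
  have hexcess (ε : ℝ) (hε : 0 < ε) : Tendsto (fun k => max (a k - ε) 0) atTop (𝓝 0) := by
    refine tendsto_zero_of_le_one_sub_mul (fun k => le_max_right _ _) hα ?_
    filter_upwards [h, hα₁, hb.eventually_le_const hε] with k hk hαk hbk
    refine max_le ?_ (mul_nonneg (sub_nonneg.2 hαk) (le_max_right _ _))
    calc a (k + 1) - ε ≤ (1 - α k) * (a k - ε) := by
          linarith [mul_le_mul_of_nonneg_left hbk (hα₀ k)]
      _ ≤ _ := mul_le_mul_of_nonneg_left (le_max_left _ _) (sub_nonneg.2 hαk)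
  refine Metric.tendsto_atTop.2 fun ε hε => eventually_atTop.1 ?_
  filter_upwards [(hexcess (ε / 2) (half_pos hε)).eventually_lt_const (half_pos hε)] with k hk
  rw [Real.dist_eq, sub_zero, abs_of_nonneg (ha k)]
  linarith [le_max_left (a k - ε / 2) 0]

end Contraction

section Drift

variable {E : Type*} [NormedAddCommGroup E] [NormedSpace ℝ E]

lemma norm_continuousAffineMap_apply_le {F : Type*} [NormedAddCommGroup F]
    [NormedSpace ℝ F] (f : E →ᴬ[ℝ] F) (y : E) : ‖f y‖ ≤ ‖f‖ * (‖y‖ + 1) := by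
  calc ‖f y‖ = ‖f.contLinear y + f 0‖ := by rw [f.decomp]; simp
    _ ≤ ‖f.contLinear‖ * ‖y‖ + ‖f 0‖ := by grw [norm_add_le, f.contLinear.le_opNorm]
    _ ≤ ‖f‖ * ‖y‖ + ‖f‖ := by grw [f.norm_contLinear_le, f.norm_image_zero_le]
    _ = ‖f‖ * (‖y‖ + 1) := by ring

/-- The near-identity change of variables `y ↦ y + H k y` of the method of averaging, whose
correction `H` is the averaging corrector of the drifts `b` with respect to `b'`. -/
noncomputable def averagingTransform (m : ℕ → ℝ) (b : ℕ → E →ᴬ[ℝ] E)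
    (b' : E →ᴬ[ℝ] E) (k : ℕ) : E →ᴬ[ℝ] E :=
  ContinuousAffineMap.id ℝ E + averagingCorrector m b b' k

lemma averagingTransform_apply (m : ℕ → ℝ) (b : ℕ → E →ᴬ[ℝ] E)
    (b' : E →ᴬ[ℝ] E) (k : ℕ) (y : E) :
    averagingTransform m b b' k y = y + averagingCorrector m b b' k y :=
  rfl

lemma norm_add_one_le_of_norm_le_half {H : E →ᴬ[ℝ] E} (hH : ‖H‖ ≤ 1 / 2)
    (y s : E) : ‖y‖ + 1 ≤ 2 * ‖y + H y - s‖ + (2 * ‖s‖ + 2) := by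
  have hHy : ‖H y‖ ≤ 1 / 2 * (‖y‖ + 1) := by grw [norm_continuousAffineMap_apply_le, hH]
  have hy : ‖y‖ ≤ ‖y + H y - s‖ + ‖s - H y‖ := by
    simpa using norm_add_le (y + H y - s) (s - H y)
  linarith [norm_sub_le s (H y)]

lemma norm_sub_le_of_norm_le_half {H : E →ᴬ[ℝ] E} (hH : ‖H‖ ≤ 1 / 2) (y s : E) :
    ‖y - s‖ ≤ 2 * ‖y + H y - s‖ + ‖H‖ * (2 * ‖s‖ + 2) := by
  have hHy : ‖H y‖ ≤ ‖y + H y - s‖ + ‖H‖ * (2 * ‖s‖ + 2) := by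
    calc ‖H y‖ ≤ ‖H‖ * (‖y‖ + 1) := norm_continuousAffineMap_apply_le H y
      _ ≤ ‖H‖ * (2 * ‖y + H y - s‖ + (2 * ‖s‖ + 2)) := by
        grw [norm_add_one_le_of_norm_le_half hH y s]
      _ = ‖H‖ * 2 * ‖y + H y - s‖ + ‖H‖ * (2 * ‖s‖ + 2) := by ring
      _ ≤ 1 / 2 * 2 * ‖y + H y - s‖ + ‖H‖ * (2 * ‖s‖ + 2) := by gcongr
      _ = ‖y + H y - s‖ + ‖H‖ * (2 * ‖s‖ + 2) := by ring
  calc ‖y - s‖ = ‖(y + H y - s) - H y‖ := by congr 1; abel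
    _ ≤ ‖y + H y - s‖ + ‖H y‖ := norm_sub_le _ _
    _ ≤ _ := by linarith

lemma averaged_step_sub_eq {b b' H H' : E →ᴬ[ℝ] E} {s : E} (hs : b' s = 0) (t : ℝ) (y : E) :
    y - t • b y + H' (y - t • b y) - s -
        (y + H y - s - t • b'.contLinear (y + H y - s)) =
      t • b'.contLinear (H y) + (H' - H - t • (b - b')) y - t • H'.contLinear (b y) := by
  have hb' : b' y = b'.contLinear (y - s) := by simpa [hs] using (b'.contLinear_map_vsub y s).symm
  have hH' : H' (y - t • b y) = H' y - t • H'.contLinear (b y) := by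
    simpa [sub_eq_neg_add] using H'.map_vadd y (-(t • b y))
  rw [hH', show y + H y - s = (y - s) + H y by abel, map_add]
  simp only [ContinuousAffineMap.sub_apply, ContinuousAffineMap.smul_apply, hb']
  module

lemma norm_averaged_step_remainder_le {b b' H H' P : E →ᴬ[ℝ] E} {t : ℝ}
    (ht : 0 ≤ t) (y : E) :
    ‖t • b'.contLinear (H y) + P y - t • H'.contLinear (b y)‖ ≤
      (t * (‖b'‖ * ‖H‖ + ‖H'‖ * ‖b‖) + ‖P‖) * (‖y‖ + 1) := by
  have hcomp (f g : E →ᴬ[ℝ] E) : ‖t • f.contLinear (g y)‖ ≤ t * (‖f‖ * (‖g‖ * (‖y‖ + 1))) := by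
    grw [norm_smul, Real.norm_of_nonneg ht, f.contLinear.le_opNorm, f.norm_contLinear_le,
      norm_continuousAffineMap_apply_le]
  grw [norm_sub_le, norm_add_le, hcomp, hcomp, norm_continuousAffineMap_apply_le]
  exact le_of_eq (by ring)

variable {m : ℕ → ℝ} {b : ℕ → E →ᴬ[ℝ] E} {b' : E →ᴬ[ℝ] E} {s : E} {C : ℝ}

lemma exists_norm_averaged_step_remainder_le (hm : IsAveragingGain m) (hb : ∀ k, ‖b k‖ ≤ C)
    (havg : Tendsto (timeAverage b) atTop (𝓝 b')) (hs : b' s = 0) :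
    ∃ η : ℕ → ℝ, Tendsto η atTop (𝓝 0) ∧ ∀ᶠ k in atTop, ∀ y,
      ‖averagingTransform m b b' (k + 1) (y - m k • b k y) - s -
        (averagingTransform m b b' k y - s -
          m k • b'.contLinear (averagingTransform m b b' k y - s))‖ ≤
        m k * η k * (‖y‖ + 1) := by
  set H := averagingCorrector m b b'
  have hH : Tendsto (fun k => ‖H k‖) atTop (𝓝 0) :=
    tendsto_zero_iff_norm_tendsto_zero.1 (tendsto_averagingCorrector hm havg)
  obtain ⟨φ, hφ, hP⟩ := (isLittleO_averagingCorrector_succ_sub hm havg).norm_left.exists_eq_mul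
  refine ⟨fun k => ‖b'‖ * ‖H k‖ + ‖H (k + 1)‖ * C + φ k, ?_, ?_⟩
  · simpa using ((hH.const_mul ‖b'‖).add
      (((tendsto_add_atTop_iff_nat 1).2 hH).mul_const C)).add hφ
  filter_upwards [hP] with k hPk y
  simp only [averagingTransform_apply, averaged_step_sub_eq hs]
  have hmk := hm.nonneg k
  grw [norm_averaged_step_remainder_le hmk, hb k, hPk]
  exact le_of_eq (by simp only [Pi.mul_apply]; ring)

lemma eventually_norm_smul_averagingTransform_contLinear_le (hm : IsAveragingGain m)
    (havg : Tendsto (timeAverage b) atTop (𝓝 b')) :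
    ∀ᶠ k in atTop, ‖m k • (averagingTransform m b b' (k + 1)).contLinear‖ ≤ m k * 2 := by
  have hH : Tendsto (fun k => ‖averagingCorrector m b b' (k + 1)‖) atTop (𝓝 0) :=
    (tendsto_add_atTop_iff_nat 1).2
      (tendsto_zero_iff_norm_tendsto_zero.1 (tendsto_averagingCorrector hm havg))
  filter_upwards [hH.eventually_le_const one_pos] with k hHk
  have hid : (averagingTransform m b b' (k + 1)).contLinear =
      ContinuousLinearMap.id ℝ E + (averagingCorrector m b b' (k + 1)).contLinear := rfl
  have hmk := hm.nonneg k
  grw [norm_smul, Real.norm_of_nonneg hmk, hid, norm_add_le,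
    ContinuousLinearMap.norm_id_le, ContinuousAffineMap.norm_contLinear_le, hHk]
  norm_num

end Drift

section Hilbert

variable {E : Type*} [NormedAddCommGroup E] [InnerProductSpace ℝ E]

lemma norm_sub_smul_le_of_coercive {A : E →L[ℝ] E} {l t : ℝ}
    (hA : ∀ u, l * ‖u‖ ^ 2 ≤ inner ℝ u (A u)) (ht : 0 ≤ t) (htA : t * ‖A‖ ^ 2 ≤ l)
    (htl : t * l ≤ 1) (u : E) : ‖u - t • A u‖ ≤ (1 - l / 2 * t) * ‖u‖ := by
  refine (sq_le_sq₀ (norm_nonneg _) (mul_nonneg (by linarith) (norm_nonneg u))).1 ?_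
  have hAu : t ^ 2 * ‖A u‖ ^ 2 ≤ t * l * ‖u‖ ^ 2 := by
    grw [A.le_opNorm, mul_pow, ← htA]
    exact le_of_eq (by ring)
  calc ‖u - t • A u‖ ^ 2 = ‖u‖ ^ 2 - 2 * (t * inner ℝ u (A u)) + t ^ 2 * ‖A u‖ ^ 2 := by
        rw [norm_sub_sq_real, inner_smul_right, norm_smul, mul_pow, Real.norm_eq_abs, sq_abs]
    _ ≤ ‖u‖ ^ 2 - 2 * (t * (l * ‖u‖ ^ 2)) + t * l * ‖u‖ ^ 2 := by grw [← hA u, hAu]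
    _ ≤ ((1 - l / 2 * t) * ‖u‖) ^ 2 := by linarith [sq_nonneg (l / 2 * t * ‖u‖)]

lemma exists_coercive_of_pos [FiniteDimensional ℝ E] {A : E →L[ℝ] E}
    (hA : ∀ u, u ≠ 0 → 0 < inner ℝ u (A u)) :
    ∃ l > 0, ∀ u, l * ‖u‖ ^ 2 ≤ inner ℝ u (A u) := by
  rcases subsingleton_or_nontrivial E with hE | hE
  · exact ⟨1, one_pos, fun u => by simp [Subsingleton.elim u 0]⟩
  have hcont : Continuous fun u : E => inner ℝ u (A u) := by fun_prop
  obtain ⟨v, hv, hmin⟩ := (isCompact_sphere (0 : E) 1).exists_isMinOn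
    (NormedSpace.sphere_nonempty.2 zero_le_one) hcont.continuousOn
  refine ⟨inner ℝ v (A v), hA v (ne_zero_of_mem_unit_sphere ⟨v, hv⟩), fun u => ?_⟩
  rcases eq_or_ne u 0 with rfl | hu
  · simp
  have hu' : ‖u‖ ≠ 0 := norm_ne_zero_iff.2 hu
  have hunit : inner ℝ v (A v) ≤ inner ℝ (‖u‖⁻¹ • u) (A (‖u‖⁻¹ • u)) :=
    hmin (by simp [norm_smul, hu'])
  calc inner ℝ v (A v) * ‖u‖ ^ 2
      ≤ inner ℝ (‖u‖⁻¹ • u) (A (‖u‖⁻¹ • u)) * ‖u‖ ^ 2 := by gcongr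
    _ = inner ℝ u (A u) := by
        rw [map_smul, real_inner_smul_left, real_inner_smul_right]
        field_simp

lemma eventually_norm_sub_smul_le_of_coercive {A : E →L[ℝ] E} {l : ℝ} {m : ℕ → ℝ}
    (hl : 0 < l) (hA : ∀ u, l * ‖u‖ ^ 2 ≤ inner ℝ u (A u)) (hm : IsAveragingGain m) :
    ∀ᶠ k in atTop, ∀ u, ‖u - m k • A u‖ ≤ (1 - l / 2 * m k) * ‖u‖ := by
  have hmA : Tendsto (fun k => m k * ‖A‖ ^ 2) atTop (𝓝 0) := by
    simpa using hm.tendsto_zero.mul_const (‖A‖ ^ 2)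
  have hml : Tendsto (fun k => m k * l) atTop (𝓝 0) := by simpa using hm.tendsto_zero.mul_const l
  filter_upwards [hmA.eventually_le_const hl, hml.eventually_le_const one_pos] with k hAk hlk
  exact norm_sub_smul_le_of_coercive hA (hm.nonneg k) hAk hlk

variable {m : ℕ → ℝ} {b : ℕ → E →ᴬ[ℝ] E} {b' : E →ᴬ[ℝ] E} {s : E} {C l : ℝ}

lemma exists_averaged_step_contraction (hm : IsAveragingGain m) (hb : ∀ k, ‖b k‖ ≤ C)
    (havg : Tendsto (timeAverage b) atTop (𝓝 b')) (hs : b' s = 0) (hl : 0 < l)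
    (hcoer : ∀ u, l * ‖u‖ ^ 2 ≤ inner ℝ u (b'.contLinear u)) :
    ∃ β > 0, ∃ η : ℕ → ℝ, Tendsto η atTop (𝓝 0) ∧ ∀ᶠ k in atTop, ∀ y,
      ‖averagingTransform m b b' (k + 1) (y - m k • b k y) - s‖ ≤
        (1 - β * m k) * ‖averagingTransform m b b' k y - s‖ + β * m k * η k := by
  obtain ⟨η, hη, hrem⟩ := exists_norm_averaged_step_remainder_le hm hb havg hs
  have hH : Tendsto (fun k => ‖averagingCorrector m b b' k‖) atTop (𝓝 0) :=
    tendsto_zero_iff_norm_tendsto_zero.1 (tendsto_averagingCorrector hm havg)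
  have hη' : Tendsto (fun k => |η k|) atTop (𝓝 0) := by simpa using hη.abs
  refine ⟨l / 4, by positivity, fun k => 4 / l * (2 * ‖s‖ + 2) * |η k|, ?_, ?_⟩
  · simpa using hη'.const_mul (4 / l * (2 * ‖s‖ + 2))
  filter_upwards [hrem, eventually_norm_sub_smul_le_of_coercive hl hcoer hm,
    hη'.eventually_le_const (show 0 < l / 8 by positivity),
    hH.eventually_le_const (half_pos one_pos)] with k hrem_k hcoer_k hη_k hH_k y
  have hmk := hm.nonneg k
  set v := averagingTransform m b b' k y - s
  have hy : ‖y‖ + 1 ≤ 2 * ‖v‖ + (2 * ‖s‖ + 2) := norm_add_one_le_of_norm_le_half hH_k y s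
  calc ‖averagingTransform m b b' (k + 1) (y - m k • b k y) - s‖
      ≤ ‖v - m k • b'.contLinear v‖ + m k * |η k| * (‖y‖ + 1) := by
        grw [← le_abs_self (η k)]
        exact (norm_le_norm_add_norm_sub' _ _).trans (add_le_add_right (hrem_k y) _)
    _ ≤ (1 - l / 2 * m k) * ‖v‖ + m k * |η k| * (2 * ‖v‖ + (2 * ‖s‖ + 2)) := by
        grw [hcoer_k v, hy]
    _ = (1 - l / 2 * m k) * ‖v‖ + m k * (2 * |η k|) * ‖v‖ + m k * |η k| * (2 * ‖s‖ + 2) := by ring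
    _ ≤ (1 - l / 2 * m k) * ‖v‖ + m k * (2 * (l / 8)) * ‖v‖ + m k * |η k| * (2 * ‖s‖ + 2) := by
        gcongr
    _ = _ := by
        field_simp
        ring

end Hilbert

section Uncorrelated

variable {E E' F : Type*} [NormedAddCommGroup E] [NormedSpace ℝ E] [NormedAddCommGroup E']
  [NormedSpace ℝ E'] [NormedAddCommGroup F] [NormedSpace ℝ F]
  {Ω : Type*} [MeasurableSpace Ω] {P : Measure Ω}

/-- Two random vectors are uncorrelated if all their scalar linear statistics have covariance
zero. The covariance is meaningful only for square-integrable vectors. -/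
def Uncorrelated (X : Ω → E) (W : Ω → F) (P : Measure Ω) : Prop :=
  ∀ (φ : StrongDual ℝ E) (ψ : StrongDual ℝ F), cov[fun ω => φ (X ω), fun ω => ψ (W ω); P] = 0

lemma uncorrelated_of_indepFun [MeasurableSpace E] [OpensMeasurableSpace E] [MeasurableSpace F]
    [OpensMeasurableSpace F] {X : Ω → E} {W : Ω → F} (h : IndepFun X W P) (hX : MemLp X 2 P)
    (hW : MemLp W 2 P) : Uncorrelated X W P := fun φ ψ =>
  (h.comp φ.continuous.measurable ψ.continuous.measurable).covariance_eq_zero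
    (hX.continuousLinearMap_comp φ) (hW.continuousLinearMap_comp ψ)

lemma memLp_continuousAffineMap_comp [IsFiniteMeasure P] {X : Ω → E} {p : ENNReal}
    (T : E →ᴬ[ℝ] E') (hX : MemLp X p P) : MemLp (fun ω => T (X ω)) p P := by
  rw [T.decomp]
  exact (hX.continuousLinearMap_comp T.contLinear).add (memLp_const _)

namespace Uncorrelated

variable {X X' : Ω → E} {W : Ω → F}

lemma symm (h : Uncorrelated X W P) : Uncorrelated W X P := fun φ ψ =>
  (covariance_comm _ _).trans (h ψ φ)

lemma add_left [IsFiniteMeasure P] (h : Uncorrelated X W P) (h' : Uncorrelated X' W P)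
    (hX : MemLp X 2 P) (hX' : MemLp X' 2 P) (hW : MemLp W 2 P) :
    Uncorrelated (fun ω => X ω + X' ω) W P := fun φ ψ => by
  simp only [map_add]
  exact (covariance_add_left (hX.continuousLinearMap_comp φ) (hX'.continuousLinearMap_comp φ)
    (hW.continuousLinearMap_comp ψ)).trans (by rw [h φ ψ, h' φ ψ, add_zero])

lemma continuousAffineMap_comp_left [IsProbabilityMeasure P] (h : Uncorrelated X W P)
    (hX : Integrable X P) (T : E →ᴬ[ℝ] E') : Uncorrelated (fun ω => T (X ω)) W P := fun φ ψ => by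
  have hT (y : E) : φ (T y) = (φ ∘L T.contLinear) y + φ (T 0) := by
    rw [congrFun T.decomp y]
    simp
  simp_rw [fun ω => hT (X ω)]
  exact (covariance_add_const_left ((φ ∘L T.contLinear).integrable_comp hX) _).trans
    (h (φ ∘L T.contLinear) ψ)

lemma continuousAffineMap_comp_right [IsProbabilityMeasure P] (h : Uncorrelated X W P)
    (hW : Integrable W P) (T : F →ᴬ[ℝ] E') : Uncorrelated X (fun ω => T (W ω)) P :=
  (h.symm.continuousAffineMap_comp_left hW T).symm

end Uncorrelated

variable {B : ℕ → E →ᴬ[ℝ] E} {T : ℕ → F →L[ℝ] E} {Y : ℕ → Ω → E} {w : ℕ → Ω → F}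

lemma memLp_of_affine_recursion [IsFiniteMeasure P] {p : ENNReal}
    (hY : ∀ k ω, Y (k + 1) ω = B k (Y k ω) + T k (w k ω)) (hY0 : MemLp (Y 0) p P)
    (hw : ∀ k, MemLp (w k) p P) (k : ℕ) : MemLp (Y k) p P := by
  induction k with
  | zero => exact hY0
  | succ k ih =>
    rw [funext (hY k)]
    exact (memLp_continuousAffineMap_comp (B k) ih).add ((hw k).continuousLinearMap_comp (T k))

lemma uncorrelated_of_affine_recursion [IsProbabilityMeasure P]
    (hY : ∀ k ω, Y (k + 1) ω = B k (Y k ω) + T k (w k ω)) (hY0 : MemLp (Y 0) 2 P)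
    (hw : ∀ k, MemLp (w k) 2 P) (hY0w : ∀ j, Uncorrelated (Y 0) (w j) P)
    (hww : ∀ k j, k ≠ j → Uncorrelated (w k) (w j) P) {k j : ℕ} (hkj : k ≤ j) :
    Uncorrelated (Y k) (w j) P := by
  induction k with
  | zero => exact hY0w j
  | succ k ih =>
    have hYk : MemLp (Y k) 2 P := memLp_of_affine_recursion hY hY0 hw k
    rw [funext (hY k)]
    exact ((ih (k.le_succ.trans hkj)).continuousAffineMap_comp_left
      (hYk.integrable one_le_two) (B k)).add_left
      (fun φ ψ => hww k j (Nat.lt_of_succ_le hkj).ne (φ ∘L T k) ψ)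
      (memLp_continuousAffineMap_comp (B k) hYk) ((hw k).continuousLinearMap_comp (T k)) (hw j)

end Uncorrelated

section SecondMoment

variable {E F : Type*} [NormedAddCommGroup E] [NormedAddCommGroup F]
  {Ω : Type*} [MeasurableSpace Ω] {P : Measure Ω}

lemma integral_norm_sq_le_of_norm_le_convexComb [IsProbabilityMeasure P] {X : Ω → E} {Z : Ω → F}
    {t a : ℝ} (hX : MemLp X 2 P) (hZ : MemLp Z 2 P) (ht₀ : 0 ≤ t) (ht₁ : t ≤ 1)
    (h : ∀ ω, ‖Z ω‖ ≤ (1 - t) * ‖X ω‖ + t * a) :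
    ∫ ω, ‖Z ω‖ ^ 2 ∂P ≤ (1 - t) * ∫ ω, ‖X ω‖ ^ 2 ∂P + t * a ^ 2 := by
  have hX2 := hX.norm.integrable_sq.const_mul (1 - t)
  calc ∫ ω, ‖Z ω‖ ^ 2 ∂P ≤ ∫ ω, ((1 - t) * ‖X ω‖ ^ 2 + t * a ^ 2) ∂P := by
        refine integral_mono hZ.norm.integrable_sq (hX2.add (integrable_const _)) fun ω => ?_
        refine (pow_le_pow_left₀ (norm_nonneg _) (h ω) 2).trans ?_
        exact even_two.convexOn_pow.2 trivial trivial (sub_nonneg.2 ht₁) ht₀ (by ring)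
    _ = (1 - t) * ∫ ω, ‖X ω‖ ^ 2 ∂P + t * a ^ 2 := by
        rw [integral_add hX2 (integrable_const _), integral_const_mul, integral_const,
          probReal_univ, one_smul]

lemma tendsto_integral_norm_sub_sq_of_add [NormedSpace ℝ E] [IsProbabilityMeasure P]
    {Y : ℕ → Ω → E} {H : ℕ → E →ᴬ[ℝ] E} {s : E} (hY : ∀ k, MemLp (Y k) 2 P)
    (hH : Tendsto H atTop (𝓝 0))
    (h : Tendsto (fun k => ∫ ω, ‖Y k ω + H k (Y k ω) - s‖ ^ 2 ∂P) atTop (𝓝 0)) :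
    Tendsto (fun k => ∫ ω, ‖Y k ω - s‖ ^ 2 ∂P) atTop (𝓝 0) := by
  have hH' : Tendsto (fun k => ‖H k‖) atTop (𝓝 0) := tendsto_zero_iff_norm_tendsto_zero.1 hH
  have hbound : Tendsto (fun k => (1 - 2⁻¹) * (4 ^ 2 * ∫ ω, ‖Y k ω + H k (Y k ω) - s‖ ^ 2 ∂P) +
      2⁻¹ * (2 * (‖H k‖ * (2 * ‖s‖ + 2))) ^ 2) atTop (𝓝 0) := by
    simpa using ((h.const_mul (4 ^ 2)).const_mul (1 - 2⁻¹)).add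
      ((((hH'.mul_const (2 * ‖s‖ + 2)).const_mul 2).pow 2).const_mul 2⁻¹)
  refine squeeze_zero' (.of_forall fun k => integral_nonneg fun ω => sq_nonneg _) ?_ hbound
  filter_upwards [hH'.eventually_le_const (half_pos one_pos)] with k hHk
  have hZ : MemLp (fun ω => Y k ω + H k (Y k ω) - s) 2 P :=
    ((hY k).add (memLp_continuousAffineMap_comp (H k) (hY k))).sub (memLp_const s)
  have hnorm (ω) : ‖(4 : ℝ) • (Y k ω + H k (Y k ω) - s)‖ = 4 * ‖Y k ω + H k (Y k ω) - s‖ := by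
    rw [norm_smul, Real.norm_ofNat]
  have hconv := integral_norm_sq_le_of_norm_le_convexComb (t := 2⁻¹)
    (a := 2 * (‖H k‖ * (2 * ‖s‖ + 2))) (hZ.const_smul (4 : ℝ)) ((hY k).sub (memLp_const s))
    (by norm_num) (by norm_num) fun ω => by
      simp only [Pi.smul_apply, Pi.sub_apply, hnorm]
      linarith [norm_sub_le_of_norm_le_half hHk (Y k ω) s]
  simpa only [Pi.smul_apply, Pi.sub_apply, hnorm, mul_pow, integral_const_mul] using hconv

lemma integral_norm_sq_map_le [NormedSpace ℝ E] [NormedSpace ℝ F] {X : Ω → E} {T : E →L[ℝ] F}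
    {c : ℝ} (hX : MemLp X 2 P) (hT : ‖T‖ ≤ c) :
    ∫ ω, ‖T (X ω)‖ ^ 2 ∂P ≤ c ^ 2 * ∫ ω, ‖X ω‖ ^ 2 ∂P := by
  rw [← integral_const_mul]
  refine integral_mono (hX.continuousLinearMap_comp T).norm.integrable_sq
    (hX.norm.integrable_sq.const_mul _) fun ω => ?_
  rw [← mul_pow]
  exact pow_le_pow_left₀ (norm_nonneg _) (T.le_of_opNorm_le hT _) 2

variable [InnerProductSpace ℝ E]

lemma integrable_inner_of_memLp_two {X W : Ω → E} (hX : MemLp X 2 P) (hW : MemLp W 2 P) :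
    Integrable (fun ω => inner ℝ (X ω) (W ω)) P := by
  refine ((L2.integrable_inner (𝕜 := ℝ) hX.toLp hW.toLp)).congr ?_
  filter_upwards [hX.coeFn_toLp, hW.coeFn_toLp] with ω hXω hWω
  rw [hXω, hWω]

lemma integral_norm_add_sq {X W : Ω → E} (hX : MemLp X 2 P) (hW : MemLp W 2 P) :
    ∫ ω, ‖X ω + W ω‖ ^ 2 ∂P =
      ∫ ω, ‖X ω‖ ^ 2 ∂P + 2 * ∫ ω, inner ℝ (X ω) (W ω) ∂P + ∫ ω, ‖W ω‖ ^ 2 ∂P := by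
  have hXW := (integrable_inner_of_memLp_two hX hW).const_mul 2
  simp only [norm_add_sq_real]
  rw [integral_add (by exact hX.norm.integrable_sq.add hXW) hW.norm.integrable_sq,
    integral_add hX.norm.integrable_sq hXW, integral_const_mul]

lemma integral_norm_sub_integral_sq_le [CompleteSpace E] [IsProbabilityMeasure P] {X : Ω → E}
    (hX : MemLp X 2 P) :
    ∫ ω, ‖X ω - ∫ ω', X ω' ∂P‖ ^ 2 ∂P ≤ ∫ ω, ‖X ω‖ ^ 2 ∂P := by
  set μ := ∫ ω, X ω ∂P
  have hinner : ∫ ω, inner ℝ (X ω) (-μ) ∂P = -‖μ‖ ^ 2 := by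
    simp_rw [real_inner_comm (-μ)]
    rw [integral_inner (hX.integrable one_le_two), inner_neg_left, real_inner_self_eq_norm_sq]
  simp only [sub_eq_add_neg]
  rw [integral_norm_add_sq hX (memLp_const (-μ)), hinner, integral_const, probReal_univ, one_smul,
    norm_neg]
  linarith [sq_nonneg ‖μ‖]

variable [FiniteDimensional ℝ E] [IsProbabilityMeasure P] {X W : Ω → E}

lemma Uncorrelated.integral_inner_eq_zero (h : Uncorrelated X W P) (hX : MemLp X 2 P)
    (hW : MemLp W 2 P) (hW₀ : ∫ ω, W ω ∂P = 0) : ∫ ω, inner ℝ (X ω) (W ω) ∂P = 0 := by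
  let v := stdOrthonormalBasis ℝ E
  have hcoord (i) : ∫ ω, inner ℝ (v i) (X ω) * inner ℝ (v i) (W ω) ∂P = 0 := by
    have hcov := h (innerSL ℝ (v i)) (innerSL ℝ (v i))
    rw [covariance_eq_sub (hX.continuousLinearMap_comp _) (hW.continuousLinearMap_comp _)] at hcov
    have hmean : ∫ ω, innerSL ℝ (v i) (W ω) ∂P = 0 := by
      rw [ContinuousLinearMap.integral_comp_comm _ (hW.integrable one_le_two), hW₀, map_zero]
    rw [hmean, mul_zero, sub_zero] at hcov
    exact hcov
  have hint (i) : Integrable (fun ω => inner ℝ (v i) (X ω) * inner ℝ (v i) (W ω)) P :=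
    (hX.continuousLinearMap_comp (innerSL ℝ (v i))).integrable_mul
      (hW.continuousLinearMap_comp (innerSL ℝ (v i)))
  have hsum (ω) : inner ℝ (X ω) (W ω) = ∑ i, inner ℝ (v i) (X ω) * inner ℝ (v i) (W ω) :=
    (v.sum_inner_mul_inner (X ω) (W ω)).symm.trans
      (Finset.sum_congr rfl fun i _ => by rw [real_inner_comm])
  simp_rw [hsum, integral_finsetSum _ fun i _ => hint i, hcoord, Finset.sum_const_zero]

lemma Uncorrelated.integral_norm_add_sq (h : Uncorrelated X W P) (hX : MemLp X 2 P)
    (hW : MemLp W 2 P) (hW₀ : ∫ ω, W ω ∂P = 0) :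
    ∫ ω, ‖X ω + W ω‖ ^ 2 ∂P = ∫ ω, ‖X ω‖ ^ 2 ∂P + ∫ ω, ‖W ω‖ ^ 2 ∂P := by
  rw [_root_.integral_norm_add_sq hX hW, h.integral_inner_eq_zero hX hW hW₀, mul_zero, add_zero]

end SecondMoment

section AveragedRecursion

variable {E Ω : Type*} [NormedAddCommGroup E] [InnerProductSpace ℝ E] [FiniteDimensional ℝ E]
  [MeasurableSpace Ω] {P : Measure Ω} [IsProbabilityMeasure P] {s : E}

lemma integral_norm_sub_sq_step_le {Φ Φ' S : E →ᴬ[ℝ] E} {Y W : Ω → E} {t a c r : ℝ}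
    (hY : MemLp Y 2 P) (hW : MemLp W 2 P) (hYW : Uncorrelated Y W P) (hW₀ : ∫ ω, W ω ∂P = 0)
    (ht₀ : 0 ≤ t) (ht₁ : t ≤ 1) (hS : ∀ y, ‖Φ' (S y) - s‖ ≤ (1 - t) * ‖Φ y - s‖ + t * a)
    (hΦ' : ‖r • Φ'.contLinear‖ ≤ c) :
    ∫ ω, ‖Φ' (S (Y ω) + r • W ω) - s‖ ^ 2 ∂P ≤
      (1 - t) * ∫ ω, ‖Φ (Y ω) - s‖ ^ 2 ∂P + t * a ^ 2 + c ^ 2 * ∫ ω, ‖W ω‖ ^ 2 ∂P := by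
  let Ψ : E →ᴬ[ℝ] E := Φ'.comp S - ContinuousAffineMap.const ℝ E s
  let Ψ₀ : E →ᴬ[ℝ] E := Φ - ContinuousAffineMap.const ℝ E s
  let T : E →L[ℝ] E := r • Φ'.contLinear
  have hΨY : MemLp (fun ω => Ψ (Y ω)) 2 P := memLp_continuousAffineMap_comp Ψ hY
  have hTW : MemLp (fun ω => T (W ω)) 2 P := hW.continuousLinearMap_comp T
  have hTW₀ : ∫ ω, T (W ω) ∂P = 0 := by
    rw [T.integral_comp_comm (hW.integrable one_le_two), hW₀, map_zero]
  have hunc : Uncorrelated (fun ω => Ψ (Y ω)) (fun ω => T (W ω)) P :=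
    (hYW.continuousAffineMap_comp_left (hY.integrable one_le_two) Ψ).continuousAffineMap_comp_right
      (hW.integrable one_le_two) T.toContinuousAffineMap
  have hsplit (ω) : Φ' (S (Y ω) + r • W ω) - s = Ψ (Y ω) + T (W ω) := by
    have hmap := Φ'.map_vadd (S (Y ω)) (r • W ω)
    rw [vadd_eq_add, vadd_eq_add, map_smul, add_comm] at hmap
    rw [hmap, add_sub_assoc, add_comm]
    rfl
  simp_rw [hsplit]
  rw [hunc.integral_norm_add_sq hΨY hTW hTW₀]
  exact add_le_add (integral_norm_sq_le_of_norm_le_convexComb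
    (memLp_continuousAffineMap_comp Ψ₀ hY) hΨY ht₀ ht₁ fun ω => hS (Y ω))
    (integral_norm_sq_map_le hW hΦ')

variable {m : ℕ → ℝ} {b : ℕ → E →ᴬ[ℝ] E} {b' : E →ᴬ[ℝ] E} {Y W : ℕ → Ω → E}
  {C C' : ℝ}

theorem tendsto_integral_norm_sub_sq_of_averaged_recursion (hm : IsAveragingGain m)
    (hb : ∀ k, ‖b k‖ ≤ C) (havg : Tendsto (timeAverage b) atTop (𝓝 b')) (hs : b' s = 0)
    (hpos : ∀ u, u ≠ 0 → 0 < inner ℝ u (b'.contLinear u))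
    (hstep : ∀ k ω, Y (k + 1) ω = Y k ω - m k • b k (Y k ω) + m k • W k ω)
    (hY : ∀ k, MemLp (Y k) 2 P) (hW : ∀ k, MemLp (W k) 2 P)
    (hWC : ∀ k, ∫ ω, ‖W k ω‖ ^ 2 ∂P ≤ C') (hW₀ : ∀ k, ∫ ω, W k ω ∂P = 0)
    (hYW : ∀ k, Uncorrelated (Y k) (W k) P) :
    Tendsto (fun k => ∫ ω, ‖Y k ω - s‖ ^ 2 ∂P) atTop (𝓝 0) := by
  obtain ⟨l, hl, hcoer⟩ := exists_coercive_of_pos hpos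
  obtain ⟨β, hβ, η, hη, hcontr⟩ := exists_averaged_step_contraction hm hb havg hs hl hcoer
  refine tendsto_integral_norm_sub_sq_of_add hY (tendsto_averagingCorrector hm havg) ?_
  have hβm : Tendsto (fun k => β * m k) atTop (𝓝 0) := by simpa using hm.tendsto_zero.const_mul β
  have hforce : Tendsto (fun k => η k ^ 2 + 4 * C' / β * m k) atTop (𝓝 0) := by
    simpa using (hη.pow 2).add (hm.tendsto_zero.const_mul (4 * C' / β))
  refine tendsto_zero_of_le_one_sub_mul_add
    (fun k => integral_nonneg fun ω => sq_nonneg _) (fun k => mul_nonneg hβ.le (hm.nonneg k))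
    (hβm.eventually_le_const one_pos)
    (by simpa only [← Finset.mul_sum] using hm.tendsto_sum.const_mul_atTop hβ) hforce ?_
  filter_upwards [hcontr, hβm.eventually_le_const one_pos,
    eventually_norm_smul_averagingTransform_contLinear_le hm havg] with k hcontr_k hβm_k hnoise_k
  have hmoment := integral_norm_sub_sq_step_le (S := ContinuousAffineMap.id ℝ E - m k • b k)
    (hY k) (hW k) (hYW k) (hW₀ k) (mul_nonneg hβ.le (hm.nonneg k)) hβm_k hcontr_k hnoise_k
  simp only [← averagingTransform_apply, hstep]
  refine hmoment.trans ?_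
  grw [hWC k]
  exact le_of_eq (by field_simp; ring)

end AveragedRecursion

section LinearRecursion

variable {E F : Type*} [NormedAddCommGroup E] [NormedAddCommGroup F]

/-- The mean drift `y ↦ L y - D γ` of the recursion `Y' = Y - m (L Y - D ε)` driven by a noise `ε`
of mean `γ`, packaged as a continuous linear function of `(L, D)` so that it commutes with time
averages. -/
noncomputable def meanDrift [NormedSpace ℝ E] [NormedSpace ℝ F] (γ : F) :
    (E →L[ℝ] E) × (F →L[ℝ] E) →L[ℝ] (E →ᴬ[ℝ] E) :=
  ((ContinuousAffineMap.decompLinearIsometryEquiv ℝ ℝ E E).symm.toContinuousLinearEquiv :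
      E × (E →L[ℝ] E) →L[ℝ] (E →ᴬ[ℝ] E)) ∘L
    (-(ContinuousLinearMap.apply ℝ E γ ∘L ContinuousLinearMap.snd ℝ _ _)).prod
      (ContinuousLinearMap.fst ℝ _ _)

lemma meanDrift_apply [NormedSpace ℝ E] [NormedSpace ℝ F] (γ : F) (L : E →L[ℝ] E)
    (D : F →L[ℝ] E) (y : E) : meanDrift γ (L, D) y = L y - D γ :=
  (sub_eq_add_neg _ _).symm

lemma meanDrift_contLinear [NormedSpace ℝ E] [NormedSpace ℝ F] (γ : F) (L : E →L[ℝ] E)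
    (D : F →L[ℝ] E) : (meanDrift γ (L, D)).contLinear = L :=
  ContinuousAffineMap.decompLinearEquiv_symm_contLinear _ _ _ _ _

lemma norm_meanDrift_le [NormedSpace ℝ E] [NormedSpace ℝ F] (γ : F) (L : E →L[ℝ] E)
    (D : F →L[ℝ] E) : ‖meanDrift γ (L, D)‖ ≤ max (‖D‖ * ‖γ‖) ‖L‖ := by
  rw [ContinuousAffineMap.norm_def, meanDrift_contLinear, meanDrift_apply, map_zero, zero_sub,
    norm_neg]
  exact max_le_max_right _ (D.le_opNorm γ)

lemma tendsto_timeAverage_meanDrift [NormedSpace ℝ E] [NormedSpace ℝ F] (γ : F)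
    {L : ℕ → E →L[ℝ] E} {L' : E →L[ℝ] E} {D : ℕ → F →L[ℝ] E} {D' : F →L[ℝ] E}
    (hL : Tendsto (timeAverage L) atTop (𝓝 L')) (hD : Tendsto (timeAverage D) atTop (𝓝 D')) :
    Tendsto (timeAverage fun k => meanDrift γ (L k, D k)) atTop (𝓝 (meanDrift γ (L', D'))) :=
  tendsto_timeAverage_map (meanDrift γ) (tendsto_timeAverage_prodMk hL hD)

variable [InnerProductSpace ℝ E] [FiniteDimensional ℝ E] [InnerProductSpace ℝ F] [CompleteSpace F]
  {Ω : Type*} [MeasurableSpace Ω] {P : Measure Ω} [IsProbabilityMeasure P]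
  {m : ℕ → ℝ} {L : ℕ → E →L[ℝ] E} {L' : E →L[ℝ] E} {D : ℕ → F →L[ℝ] E} {D' : F →L[ℝ] E}
  {Y : ℕ → Ω → E} {ε : ℕ → Ω → F} {γ : F} {s : E} {C C' : ℝ}

theorem tendsto_integral_norm_sub_sq_of_linear_recursion (hm : IsAveragingGain m)
    (hLC : ∀ k, ‖L k‖ ≤ C) (hDC : ∀ k, ‖D k‖ ≤ C) (hL : Tendsto (timeAverage L) atTop (𝓝 L'))
    (hD : Tendsto (timeAverage D) atTop (𝓝 D')) (hpos : ∀ u, u ≠ 0 → 0 < inner ℝ u (L' u))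
    (hs : L' s = D' γ)
    (hstep : ∀ k ω, Y (k + 1) ω = Y k ω - m k • L k (Y k ω) + m k • D k (ε k ω))
    (hY : ∀ k, MemLp (Y k) 2 P) (hε : ∀ k, MemLp (ε k) 2 P) (hεγ : ∀ k, ∫ ω, ε k ω ∂P = γ)
    (hεC : ∀ k, ∫ ω, ‖ε k ω‖ ^ 2 ∂P ≤ C') (hYε : ∀ k, Uncorrelated (Y k) (ε k) P) :
    Tendsto (fun k => ∫ ω, ‖Y k ω - s‖ ^ 2 ∂P) atTop (𝓝 0) := by
  let centre : F →ᴬ[ℝ] F := ContinuousAffineMap.id ℝ F - ContinuousAffineMap.const ℝ F γ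
  have hcentred (k) : MemLp (fun ω => ε k ω - γ) 2 P := (hε k).sub (memLp_const γ)
  have hstep' (k ω) : Y (k + 1) ω =
      Y k ω - m k • meanDrift γ (L k, D k) (Y k ω) + m k • D k (ε k ω - γ) := by
    rw [hstep, meanDrift_apply, map_sub]
    module
  have hdrift (k) : ‖meanDrift γ (L k, D k)‖ ≤ max (C * ‖γ‖) C := by
    grw [norm_meanDrift_le, hLC k, hDC k]
  have hnoise (k) : ∫ ω, ‖D k (ε k ω - γ)‖ ^ 2 ∂P ≤ C ^ 2 * C' := by
    grw [integral_norm_sq_map_le (hcentred k) (hDC k), ← hεC k, ← hεγ k,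
      integral_norm_sub_integral_sq_le (hε k)]
  have hmean (k) : ∫ ω, D k (ε k ω - γ) ∂P = 0 := by
    rw [(D k).integral_comp_comm ((hcentred k).integrable one_le_two),
      integral_sub ((hε k).integrable one_le_two) (integrable_const γ), hεγ k, integral_const,
      probReal_univ, one_smul, sub_self, map_zero]
  exact tendsto_integral_norm_sub_sq_of_averaged_recursion hm hdrift
    (tendsto_timeAverage_meanDrift γ hL hD)
    ((meanDrift_apply γ L' D' s).trans (sub_eq_zero.2 hs))
    (by simpa only [meanDrift_contLinear, ContinuousLinearMap.coe_coe] using hpos) hstep' hY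
    (fun k => (hcentred k).continuousLinearMap_comp (D k)) hnoise hmean fun k =>
      (hYε k).continuousAffineMap_comp_right ((hε k).integrable one_le_two)
        ((D k).toContinuousAffineMap.comp centre)

end LinearRecursion

section GraphMatrices

variable {B R : Type*} [Fintype B] [DecidableEq B] [Fintype R] [DecidableEq R]

lemma groundedLaplacian_mulVec_apply (G : SimpleGraph (B ⊕ R)) [DecidableRel G.Adj]
    {z : B ⊕ R → ℝ} (hz : ∀ r, z (Sum.inr r) = 0) (u : B) :
    (groundedLaplacian G).mulVec (z ∘ Sum.inl) u = (G.lapMatrix ℝ).mulVec z (Sum.inl u) := by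
  simp [Matrix.mulVec, dotProduct, groundedLaplacian, Fintype.sum_sum_type, hz]

lemma dotProduct_groundedLaplacian_mulVec (G : SimpleGraph (B ⊕ R)) [DecidableRel G.Adj]
    (y : B → ℝ) :
    y ⬝ᵥ (groundedLaplacian G).mulVec y =
      Matrix.toLinearMap₂' ℝ (G.lapMatrix ℝ) (Sum.elim y 0) (Sum.elim y 0) := by
  have hmulVec := groundedLaplacian_mulVec_apply G (z := Sum.elim y 0) fun _ => rfl
  rw [Sum.elim_comp_inl] at hmulVec
  simp [Matrix.toLinearMap₂'_apply', dotProduct, Fintype.sum_sum_type, hmulVec]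

lemma dotProduct_groundedLaplacian_mulVec_nonneg (G : SimpleGraph (B ⊕ R)) [DecidableRel G.Adj]
    (y : B → ℝ) : 0 ≤ y ⬝ᵥ (groundedLaplacian G).mulVec y := by
  rw [dotProduct_groundedLaplacian_mulVec, Matrix.toLinearMap₂'_apply']
  exact (SimpleGraph.posSemidef_lapMatrix ℝ G).dotProduct_mulVec_nonneg _

lemma dotProduct_groundedLaplacian_mulVec_eq_zero_iff (G : SimpleGraph (B ⊕ R))
    [DecidableRel G.Adj] (y : B → ℝ) :
    y ⬝ᵥ (groundedLaplacian G).mulVec y = 0 ↔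
      ∀ i j, G.Adj i j → Sum.elim y (0 : R → ℝ) i = Sum.elim y 0 j := by
  rw [dotProduct_groundedLaplacian_mulVec,
    SimpleGraph.lapMatrix_toLinearMap₂'_apply'_eq_zero_iff_forall_adj]

lemma exists_dotProduct_groundedLaplacian_mulVec_ne_zero [Nonempty R] {ι : Type*}
    {G : ι → SimpleGraph (B ⊕ R)} [∀ k, DecidableRel (G k).Adj] {S : Set ι}
    (hG : (⨆ k ∈ S, G k).Connected) {y : B → ℝ} (hy : y ≠ 0) :
    ∃ k ∈ S, y ⬝ᵥ (groundedLaplacian (G k)).mulVec y ≠ 0 := by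
  classical
  by_contra! hzero
  have hadj (i j) (hij : (⨆ k ∈ S, G k).Adj i j) : Sum.elim y (0 : R → ℝ) i = Sum.elim y 0 j := by
    simp only [SimpleGraph.iSup_adj] at hij
    obtain ⟨k, hk, hij⟩ := hij
    exact (dotProduct_groundedLaplacian_mulVec_eq_zero_iff (G k) y).1 (hzero k hk) i j hij
  have hconst := (SimpleGraph.lapMatrix_mulVec_eq_zero_iff_forall_reachable _).1
    ((SimpleGraph.lapMatrix_mulVec_eq_zero_iff_forall_adj _).2 hadj)
  obtain ⟨r⟩ := ‹Nonempty R›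
  exact hy (funext fun u => hconst (Sum.inl u) (Sum.inr r) (hG.preconnected _ _))

lemma finite_range_of_simpleGraph {V α : Type*} [Finite V] {ι : Type*} (G : ι → SimpleGraph V)
    [∀ k, DecidableRel (G k).Adj] (f : (H : SimpleGraph V) → DecidableRel H.Adj → α) :
    (Set.range fun k => f (G k) inferInstance).Finite := by
  classical
  refine (Set.finite_range fun H => f H (Classical.decRel _)).subset ?_
  rintro _ ⟨k, rfl⟩
  exact ⟨G k, congrArg (f (G k)) (Subsingleton.elim _ _)⟩

lemma exists_pos_forall_le_of_finite_range {ι : Type*} {q : ι → ℝ} (hfin : (Set.range q).Finite)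
    (hq : ∀ k, 0 ≤ q k) : ∃ δ > 0, ∀ k, q k ≠ 0 → δ ≤ q k := by
  obtain ⟨δ, hδ, hmin⟩ := Set.exists_min_image (insert 1 (Set.range q \ {0})) id
    (hfin.sdiff.insert 1) (Set.insert_nonempty _ _)
  refine ⟨δ, ?_, fun k hk => hmin (q k) (Or.inr ⟨⟨k, rfl⟩, hk⟩)⟩
  rcases hδ with rfl | ⟨⟨k, rfl⟩, hk⟩
  · exact one_pos
  · exact (hq k).lt_of_ne' hk

lemma exists_pos_forall_le_sum_dotProduct_groundedLaplacian_mulVec [Nonempty R]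
    {G : ℕ → SimpleGraph (B ⊕ R)} [∀ k, DecidableRel (G k).Adj] {d : ℕ}
    (hconn : ∀ t, (⨆ k ∈ Set.Ico t (t + d), G k).Connected) {y : B → ℝ} (hy : y ≠ 0) :
    ∃ δ > 0, ∀ t, δ ≤ ∑ k ∈ Finset.Ico t (t + d), y ⬝ᵥ (groundedLaplacian (G k)).mulVec y := by
  have hnonneg (k) := dotProduct_groundedLaplacian_mulVec_nonneg (G k) y
  obtain ⟨δ, hδ, hle⟩ := exists_pos_forall_le_of_finite_range
    (finite_range_of_simpleGraph G fun H _ => y ⬝ᵥ (groundedLaplacian H).mulVec y) hnonneg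
  refine ⟨δ, hδ, fun t => ?_⟩
  obtain ⟨k, hk, hne⟩ := exists_dotProduct_groundedLaplacian_mulVec_ne_zero (hconn t) hy
  exact (hle k hne).trans
    (Finset.single_le_sum (fun j _ => hnonneg j) (Finset.mem_Ico.2 ⟨hk.1, hk.2⟩))

lemma dotProduct_mulVec_pos_of_tendsto_timeAverage_groundedLaplacian [Nonempty R]
    {G : ℕ → SimpleGraph (B ⊕ R)} [∀ k, DecidableRel (G k).Adj] {d : ℕ}
    (hconn : ∀ t, (⨆ k ∈ Set.Ico t (t + d), G k).Connected) {L : Matrix B B ℝ}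
    (hL : Tendsto (timeAverage fun k => groundedLaplacian (G k)) atTop (𝓝 L))
    {y : B → ℝ} (hy : y ≠ 0) : 0 < y ⬝ᵥ L.mulVec y := by
  let form : Matrix B B ℝ →L[ℝ] ℝ :=
    { toFun M := y ⬝ᵥ M.mulVec y
      map_add' M N := by rw [Matrix.add_mulVec, dotProduct_add]
      map_smul' c M := by rw [Matrix.smul_mulVec, dotProduct_smul, RingHom.id_apply]
      cont := by fun_prop }
  obtain ⟨δ, hδ, hwindow⟩ :=
    exists_pos_forall_le_sum_dotProduct_groundedLaplacian_mulVec hconn hy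
  exact pos_of_tendsto_timeAverage
    (fun k => dotProduct_groundedLaplacian_mulVec_nonneg (G k) y) hδ hwindow
    (tendsto_timeAverage_map form hL)

lemma isUnit_det_of_dotProduct_mulVec_pos {n : Type*} [Fintype n] [DecidableEq n]
    {A : Matrix n n ℝ} (hA : ∀ y, y ≠ 0 → 0 < y ⬝ᵥ A.mulVec y) : IsUnit A.det := by
  refine isUnit_iff_ne_zero.2 fun hdet => ?_
  obtain ⟨y, hy, hAy⟩ := Matrix.exists_mulVec_eq_zero_iff.2 hdet
  simpa [hAy] using hA y hy

lemma weightMatrix_mulVec_stackedNoise (G : SimpleGraph (B ⊕ R)) [DecidableRel G.Adj]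
    (ξ : B → B ⊕ R → ℝ) (u : B) :
    (weightMatrix G).mulVec (stackedNoise ξ).ofLp u =
      ∑ v ∈ G.neighborFinset (Sum.inl u), ξ u v := by
  let f (p : B × (B ⊕ R)) : ℝ :=
    (if p.1 = u then G.adjMatrix ℝ (Sum.inl u) p.2 else 0) * ξ p.1 p.2
  have hdiag (p : B × (B ⊕ R)) (hp : p.2 = Sum.inl p.1) : f p = 0 := by
    by_cases hu : p.1 = u <;> simp [f, hp, hu]
  calc (weightMatrix G).mulVec (stackedNoise ξ).ofLp u = ∑ p : NodePair B R, f p := rfl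
    _ = ∑ p, f p := Fintype.sum_of_injective _ Subtype.val_injective _ _
        (fun p hp => hdiag p (by simpa using hp)) fun _ => rfl
    _ = ∑ v, f (u, v) := by
        rw [Fintype.sum_prod_type]
        exact Fintype.sum_eq_single u fun w hw => by simp [f, hw]
    _ = (G.adjMatrix ℝ).mulVec (ξ u) (Sum.inl u) := by simp [f, Matrix.mulVec, dotProduct]
    _ = ∑ v ∈ G.neighborFinset (Sum.inl u), ξ u v := G.adjMatrix_mulVec_apply _ _

end GraphMatrices

section DiSync

variable {B R : Type*} [Fintype B] [Fintype R]

variable (m : ℕ → ℝ) (G : ℕ → SimpleGraph (B ⊕ R)) [∀ k, DecidableRel (G k).Adj]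
  (x : B ⊕ R → ℝ) (ξ : ℕ → B → B ⊕ R → ℝ) (x₀ : B → ℝ) (k : ℕ)

lemma diSyncEstimate_inr (r : R) : diSyncEstimate m G x ξ x₀ k (Sum.inr r) = x (Sum.inr r) := by
  cases k <;> rfl

variable [DecidableEq B] [DecidableEq R]

lemma groundedLaplacian_mulVec_diSyncError (u : B) :
    (groundedLaplacian (G k)).mulVec (diSyncError m G x ξ x₀ k).ofLp u =
      ∑ v ∈ (G k).neighborFinset (Sum.inl u),
        ((diSyncEstimate m G x ξ x₀ k (Sum.inl u) - x (Sum.inl u)) -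
          (diSyncEstimate m G x ξ x₀ k v - x v)) := by
  refine (groundedLaplacian_mulVec_apply (G k) (z := diSyncEstimate m G x ξ x₀ k - x)
    (fun r => sub_eq_zero.2 (diSyncEstimate_inr m G x ξ x₀ k r)) u).trans ?_
  rw [SimpleGraph.lapMatrix_mulVec_apply, Finset.sum_sub_distrib, Finset.sum_const,
    SimpleGraph.card_neighborFinset_eq_degree, nsmul_eq_mul]
  rfl

lemma diSyncError_succ :
    (diSyncError m G x ξ x₀ (k + 1)).ofLp =
      Matrix.mulVec (1 - m k • groundedLaplacian (G k)) (diSyncError m G x ξ x₀ k).ofLp +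
        m k • Matrix.mulVec (weightMatrix (G k)) (stackedNoise (ξ k)).ofLp := by
  ext u
  have hinnovation : ∑ v ∈ (G k).neighborFinset (Sum.inl u),
      (diSyncEstimate m G x ξ x₀ k v + diffMeasurement x (ξ k) u v -
        diSyncEstimate m G x ξ x₀ k (Sum.inl u)) =
      (weightMatrix (G k)).mulVec (stackedNoise (ξ k)).ofLp u -
        (groundedLaplacian (G k)).mulVec (diSyncError m G x ξ x₀ k).ofLp u := by
    rw [weightMatrix_mulVec_stackedNoise, groundedLaplacian_mulVec_diSyncError,
      ← Finset.sum_sub_distrib]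
    exact Finset.sum_congr rfl fun v _ => by rw [diffMeasurement]; ring
  rw [Matrix.sub_mulVec, Matrix.one_mulVec, Matrix.smul_mulVec]
  simp only [diSyncError, diSyncEstimate, Sum.elim_inl, Pi.add_apply, Pi.sub_apply, Pi.smul_apply,
    smul_eq_mul] at hinnovation ⊢
  rw [hinnovation]
  ring

end DiSync

section EuclideanMatrix

variable {ι κ : Type*} [Fintype ι] [Fintype κ] [DecidableEq κ]

/-- The action of rectangular real matrices on Euclidean vectors, as a continuous linear function of
the matrix so that it commutes with time averages. -/
noncomputable def euclideanCLM :
    Matrix ι κ ℝ →L[ℝ] (EuclideanSpace ℝ κ →L[ℝ] EuclideanSpace ℝ ι) :=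
  LinearMap.toContinuousLinearMap
    (LinearMap.toContinuousLinearMap.toLinearMap ∘ₗ (Matrix.toLpLin 2 2).toLinearMap)

lemma euclideanCLM_apply (A : Matrix ι κ ℝ) (y : EuclideanSpace ℝ κ) :
    euclideanCLM A y = WithLp.toLp 2 (A.mulVec y.ofLp) :=
  rfl

lemma inner_euclideanCLM_self [DecidableEq ι] (A : Matrix ι ι ℝ) (y : EuclideanSpace ℝ ι) :
    inner ℝ y (euclideanCLM A y) = y.ofLp ⬝ᵥ A.mulVec y.ofLp := by
  rw [EuclideanSpace.inner_eq_star_dotProduct, euclideanCLM_apply, star_trivial, dotProduct_comm]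

end EuclideanMatrix

section Convergence

variable {B R : Type*} [Fintype B] [DecidableEq B] [Fintype R] [DecidableEq R]

lemma exists_forall_norm_euclideanCLM_le (G : ℕ → SimpleGraph (B ⊕ R))
    [∀ k, DecidableRel (G k).Adj] :
    ∃ C, ∀ k, ‖euclideanCLM (groundedLaplacian (G k))‖ ≤ C ∧
      ‖euclideanCLM (weightMatrix (G k))‖ ≤ C := by
  obtain ⟨C, hC⟩ := (finite_range_of_simpleGraph G fun H _ =>
    (euclideanCLM (groundedLaplacian H), euclideanCLM (weightMatrix H))).isBounded.exists_norm_le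
  exact ⟨C, fun k => norm_prod_le_iff.1 (hC _ ⟨k, rfl⟩)⟩

lemma diSyncError_succ_eq_sub_add (m : ℕ → ℝ) (G : ℕ → SimpleGraph (B ⊕ R))
    [∀ k, DecidableRel (G k).Adj] (x : B ⊕ R → ℝ) (ξ : ℕ → B → B ⊕ R → ℝ) (x₀ : B → ℝ) (k : ℕ) :
    diSyncError m G x ξ x₀ (k + 1) =
      diSyncError m G x ξ x₀ k -
        m k • euclideanCLM (groundedLaplacian (G k)) (diSyncError m G x ξ x₀ k) +
        m k • euclideanCLM (weightMatrix (G k)) (stackedNoise (ξ k)) := by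
  apply WithLp.ofLp_injective 2
  rw [diSyncError_succ, Matrix.sub_mulVec, Matrix.one_mulVec, Matrix.smul_mulVec]
  rfl

theorem theorem1_general [Nonempty R] {Ω : Type*} [MeasurableSpace Ω] (P : Measure Ω)
    [IsProbabilityMeasure P] (x : B ⊕ R → ℝ) (G : ℕ → SimpleGraph (B ⊕ R))
    [∀ k, DecidableRel (G k).Adj] (ξ : ℕ → Ω → B → B ⊕ R → ℝ) (x₀ : Ω → B → ℝ)
    (ε : ℕ → Ω → EuclideanSpace ℝ (NodePair B R)) (hε : ∀ k ω, ε k ω = stackedNoise (ξ k ω))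
    {m : ℕ → ℝ} (hm : IsAveragingGain m) (e : ℕ → Ω → EuclideanSpace ℝ B)
    (he : ∀ k ω, e k ω = diSyncError m G x (fun j => ξ j ω) (x₀ ω) k)
    {γ : EuclideanSpace ℝ (NodePair B R)} (hε_L2 : ∀ k, MemLp (ε k) 2 P)
    (hε_mean : ∀ k, ∫ ω, ε k ω ∂P = γ) (hε_bdd : ∃ C : ℝ, ∀ k, ∫ ω, ‖ε k ω‖ ^ 2 ∂P ≤ C)
    (hε_uncorr : ∀ k j, k ≠ j → Uncorrelated (ε k) (ε j) P) (he0_L2 : MemLp (e 0) 2 P)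
    (he0_uncorr : ∀ k, Uncorrelated (e 0) (ε k) P)
    (hconn : ∃ d : ℕ, ∀ t : ℕ, (⨆ k ∈ Set.Ico t (t + d), G k).Connected)
    {Lbbar : Matrix B B ℝ} {Dbar : Matrix B (NodePair B R) ℝ}
    (hLb : Tendsto (timeAverage fun k => groundedLaplacian (G k)) atTop (𝓝 Lbbar))
    (hD : Tendsto (timeAverage fun k => weightMatrix (G k)) atTop (𝓝 Dbar)) :
    (∀ k ω, (e (k + 1) ω).ofLp =
      Matrix.mulVec (1 - m k • groundedLaplacian (G k)) (e k ω).ofLp +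
        m k • Matrix.mulVec (weightMatrix (G k)) (ε k ω).ofLp) ∧
    IsUnit Lbbar.det ∧ (∀ k, MemLp (e k) 2 P) ∧
    Tendsto (fun k => ∫ ω, ‖e k ω -
        WithLp.toLp 2 (Matrix.mulVec Lbbar⁻¹ (Matrix.mulVec Dbar γ.ofLp))‖ ^ 2 ∂P)
      atTop (𝓝 0) ∧
    (γ = 0 → Tendsto (fun k => ∫ ω, ‖e k ω‖ ^ 2 ∂P) atTop (𝓝 0)) := by
  obtain ⟨C, hC⟩ := exists_forall_norm_euclideanCLM_le G
  obtain ⟨C', hC'⟩ := hε_bdd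
  obtain ⟨d, hconn⟩ := hconn
  have hpos (y : B → ℝ) (hy : y ≠ 0) : 0 < y ⬝ᵥ Lbbar.mulVec y :=
    dotProduct_mulVec_pos_of_tendsto_timeAverage_groundedLaplacian hconn hLb hy
  have hdet : IsUnit Lbbar.det := isUnit_det_of_dotProduct_mulVec_pos hpos
  have hstep (k ω) : e (k + 1) ω = e k ω - m k • euclideanCLM (groundedLaplacian (G k)) (e k ω) +
      m k • euclideanCLM (weightMatrix (G k)) (ε k ω) := by
    rw [he, he, hε, diSyncError_succ_eq_sub_add]
  let A (k : ℕ) : EuclideanSpace ℝ B →ᴬ[ℝ] EuclideanSpace ℝ B :=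
    (.id ℝ _ - m k • euclideanCLM (groundedLaplacian (G k)) :
      EuclideanSpace ℝ B →L[ℝ] EuclideanSpace ℝ B).toContinuousAffineMap
  have hA (k ω) : e (k + 1) ω = A k (e k ω) + (m k • euclideanCLM (weightMatrix (G k))) (ε k ω) :=
    hstep k ω
  have hmemLp : ∀ k, MemLp (e k) 2 P := memLp_of_affine_recursion hA he0_L2 hε_L2
  have hlimit : euclideanCLM Lbbar (WithLp.toLp 2 (Lbbar⁻¹.mulVec (Dbar.mulVec γ.ofLp))) =
      euclideanCLM Dbar γ := by
    rw [euclideanCLM_apply, Matrix.mulVec_mulVec, Matrix.mul_nonsing_inv _ hdet,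
      Matrix.one_mulVec, euclideanCLM_apply]
  have hconv := tendsto_integral_norm_sub_sq_of_linear_recursion hm (fun k => (hC k).1)
    (fun k => (hC k).2) (tendsto_timeAverage_map euclideanCLM hLb)
    (tendsto_timeAverage_map euclideanCLM hD)
    (fun y hy => (inner_euclideanCLM_self Lbbar y).symm ▸
      hpos y.ofLp ((WithLp.ofLp_eq_zero 2).not.2 hy))
    hlimit hstep hmemLp hε_L2 hε_mean hC' fun k =>
      uncorrelated_of_affine_recursion hA he0_L2 hε_L2 he0_uncorr hε_uncorr le_rfl
  refine ⟨fun k ω => ?_, hdet, hmemLp, hconv, fun hγ => by simpa [hγ] using hconv⟩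
  rw [he, he, hε, diSyncError_succ]

end Convergence

theorem theorem1 {B R Ω : Type*} [Fintype B] [DecidableEq B] [Fintype R] [DecidableEq R]
    [Nonempty R] [MeasurableSpace Ω] (P : Measure Ω) [IsProbabilityMeasure P]
    -- node variables, measurement graphs, measurement noises, initial estimates
    (x : B ⊕ R → ℝ) (G : ℕ → SimpleGraph (B ⊕ R)) [∀ k, DecidableRel (G k).Adj]
    (ξ : ℕ → Ω → B → B ⊕ R → ℝ) (x₀ : Ω → B → ℝ)
    -- the stacked noise vector `ε(k)`
    (ε : ℕ → Ω → EuclideanSpace ℝ (NodePair B R))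
    (hε : ∀ k ω, ε k ω = stackedNoise (ξ k ω))
    -- the gains
    (m : ℕ → ℝ) (c₁ c₂ : ℝ) (hc₁ : 0 < c₁) (hc₂ : 0 < c₂)
    (hm : ∀ k, m k = c₁ / ((k : ℝ) + c₂))
    -- the estimation error `e(k)`
    (e : ℕ → Ω → EuclideanSpace ℝ B)
    (he : ∀ k ω, e k ω = diSyncError m G x (fun j => ξ j ω) (x₀ ω) k)
    -- noise: constant mean, bounded second moments, independence
    (γ : EuclideanSpace ℝ (NodePair B R))
    (hε_meas : ∀ k, Measurable (ε k)) (hε_L2 : ∀ k, MemLp (ε k) 2 P)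
    (hε_mean : ∀ k, ∫ ω, ε k ω ∂P = γ)
    (hε_bdd : ∃ C : ℝ, ∀ k, ∫ ω, ‖ε k ω‖ ^ 2 ∂P ≤ C)
    (hε_indep : ∀ k j, k ≠ j → IndepFun (ε k) (ε j) P)
    (he0_meas : Measurable (e 0)) (he0_L2 : MemLp (e 0) 2 P)
    (hε_e0 : IndepFun (fun ω k => ε k ω) (e 0) P)
    -- uniform joint connectivity
    (hconn : ∃ d : ℕ, ∀ t : ℕ, (⨆ k ∈ Set.Ico t (t + d), G k).Connected)
    -- existence of the time averages
    (Lbar : Matrix (B ⊕ R) (B ⊕ R) ℝ) (Lbbar : Matrix B B ℝ)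
    (Dbar : Matrix B (NodePair B R) ℝ)
    (hL : Tendsto (timeAverage fun k => (G k).lapMatrix ℝ) atTop (𝓝 Lbar))
    (hLb : Tendsto (timeAverage fun k => groundedLaplacian (G k)) atTop (𝓝 Lbbar))
    (hD : Tendsto (timeAverage fun k => weightMatrix (G k)) atTop (𝓝 Dbar)) :
    -- the error obeys the grounded Laplacian recursion
    (∀ k ω, (e (k + 1) ω).ofLp =
      Matrix.mulVec (1 - m k • groundedLaplacian (G k)) (e k ω).ofLp +
        m k • Matrix.mulVec (weightMatrix (G k)) (ε k ω).ofLp) ∧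
    -- the limit is well defined and the mean square error is finite
    IsUnit Lbbar.det ∧ (∀ k, MemLp (e k) 2 P) ∧
    -- mean square convergence
    Tendsto (fun k => ∫ ω, ‖e k ω -
        WithLp.toLp 2 (Matrix.mulVec Lbbar⁻¹ (Matrix.mulVec Dbar γ.ofLp))‖ ^ 2 ∂P)
      atTop (𝓝 0) ∧
    (γ = 0 → Tendsto (fun k => ∫ ω, ‖e k ω‖ ^ 2 ∂P) atTop (𝓝 0)) := by
  obtain rfl : m = fun k : ℕ => c₁ / ((k : ℝ) + c₂) := funext hm
  exact theorem1_general P x G ξ x₀ ε hε (isAveragingGain_div_add hc₁ hc₂) e he hε_L2 hε_mean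
    hε_bdd (fun k j hkj => uncorrelated_of_indepFun (hε_indep k j hkj) (hε_L2 k) (hε_L2 j)) he0_L2
    (fun k => (uncorrelated_of_indepFun (hε_e0.comp (measurable_pi_apply k) measurable_id)
      (hε_L2 k) he0_L2).symm) hconn hLb hD
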